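/- Let $W(\cdot|\cdot)$ be a discrete memoryless channel with finite input alphabet $\mathcal X$ and finite output alphabet $\mathcal Y$, let $0\in\mathcal X$ be a designated "off" input symbol, and write $Q_0=W(\cdot|0)$. Assume that $Q_0(y)>0$ for every $y\in\mathcal Y$, and let $\delta>0$. All logarithms are natural. A deterministic code of blocklength $n$ for a finite message set $\mathcal M$ consists of an encoder $\mathcal M\to\mathcal X^n$ and a decoder $\mathcal Y^n\to\mathcal M$; a random code is a probability distribution on such codes, the drawn code being known to both the encoder and the decoder. A random code, together with an independent uniform message, induces a distribution $Q^n$ on $\mathcal Y^n$, the law of the channel outputs averaged over the code and the message. For $\epsilon>0$ let $K_n(\delta,\epsilon)$ be the largest value of $\log|\mathcal M|$ for which there is a random code of blocklength $n$ whose average probability of error (over message, code and channel) is at most $\epsilon$ and which satisfies $D(Q^n\,\|\,Q_0^{\times n})\le\delta$, where $D$ denotes relative entropy and $Q_0^{\times n}$ the $n$-fold product of $Q_0$. Put $$L=\lim_{\epsilon\downarrow0}\ \liminf_{n\to\infty}\ \frac{K_n(\delta,\epsilon)}{\sqrt{n\delta}} .$$ **Theorem 3.** Suppose that there is a capacity-achieving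 input distribution (a distribution $P$ on $\mathcal X$ maximizing the mutual information $I(P,W)$) with $P(x)>0$ for every $x\in\mathcal X$. Let $Q^*$ be the capacity-achieving output distribution, i.e. the output distribution induced through $W$ by a capacity-achieving input distribution. Then $$L\le\sqrt{2\,\mathrm{var}_{Q_0}\!\left(\log\frac{Q_0(Y)}{Q^*(Y)}\right)},$$ where $\mathrm{var}_{Q_0}(\cdot)$ denotes the variance of a function of $Y$ when $Y$ has distribution $Q_0$. -/

import Mathlib

open Filter Topology

namespace LPD

noncomputable section

/-- A discrete memoryless channel with finite output alphabet `Y`: each input symbol `x` induces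
a probability distribution `W(· | x)` on `Y`, given by its mass function `law x`. -/
structure DMC (X Y : Type*) [Fintype Y] where
  law : X → Y → ℝ
  law_mem : ∀ x, law x ∈ stdSimplex ℝ Y

variable {X Y : Type*} [Fintype X] [Fintype Y]

open Classical in
/-- Relative entropy `D(P ‖ Q)` (in nats) of mass functions on a finite set; it is `⊤` unless the
support of `P` is contained in the support of `Q`. -/
def relEntropy {A : Type*} [Fintype A] (P Q : A → ℝ) : EReal :=
  if ∀ a, Q a = 0 → P a = 0 then ((∑ a, P a * Real.log (P a / Q a) : ℝ) : EReal) else ⊤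

/-- The mean of `f(Y)` when `Y` has mass function `Q`. -/
def mean {A : Type*} [Fintype A] (Q : A → ℝ) (f : A → ℝ) : ℝ := ∑ a, Q a * f a

/-- The variance of `f(Y)` when `Y` has mass function `Q`. -/
def variance {A : Type*} [Fintype A] (Q : A → ℝ) (f : A → ℝ) : ℝ :=
  ∑ a, Q a * (f a - mean Q f) ^ 2

/-- The output distribution induced by the input distribution `P`. -/
def output (W : DMC X Y) (P : X → ℝ) (y : Y) : ℝ := ∑ x, P x * W.law x y

/-- The mutual information `I(P, W)` in nats.  If `P x * W.law x y ≠ 0` for a distribution `P`, the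
denominator is positive; all other terms vanish. -/
def mutualInfo (W : DMC X Y) (P : X → ℝ) : ℝ :=
  ∑ x, ∑ y, P x * W.law x y * Real.log (W.law x y / output W P y)

/-- `P` is a capacity-achieving input distribution: it maximizes `I(·, W)` among all input
distributions. -/
def IsCapacityAchieving (W : DMC X Y) (P : X → ℝ) : Prop :=
  P ∈ stdSimplex ℝ X ∧ IsMaxOn (mutualInfo W) (stdSimplex ℝ X) P

/-- `Q` is a capacity-achieving output distribution: it is induced by some capacity-achieving input
distribution. -/
def IsCapacityAchievingOutput (W : DMC X Y) (Q : Y → ℝ) : Prop :=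
  ∃ P, IsCapacityAchieving W P ∧ Q = output W P

/-- The law of the `n` channel outputs when the input sequence is `x`. -/
def blockLaw (W : DMC X Y) {n : ℕ} (x : Fin n → X) (y : Fin n → Y) : ℝ :=
  ∏ i, W.law (x i) (y i)

/-- Deterministic codes of blocklength `n` with `m` messages: an encoder and a decoder. -/
abbrev Code (X Y : Type*) (n m : ℕ) : Type _ :=
  (Fin m → Fin n → X) × ((Fin n → Y) → Fin m)

variable [DecidableEq Y]

/-- The distribution of the `n` channel outputs when the code is drawn from `μ` and the message is
uniform and independent of the code. -/
def codeOutput (W : DMC X Y) {n m : ℕ} (μ : Code X Y n m → ℝ) (y : Fin n → Y) : ℝ :=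
  ∑ c, μ c * ((∑ k, blockLaw W (c.1 k) y) / m)

/-- The average probability of error when the code is drawn from `μ` (the draw being known to both
encoder and decoder) and the message is uniform and independent of the code. -/
def errorProb (W : DMC X Y) {n m : ℕ} (μ : Code X Y n m → ℝ) : ℝ :=
  ∑ c, μ c * ((∑ k, ∑ y with c.2 y ≠ k, blockLaw W (c.1 k) y) / m)

/-- There is a random code of blocklength `n` with `m` messages, average error probability at most
`ε`, and whose output distribution is within relative entropy `δ` of the output distribution seen
when the off symbol `o` is sent all the time. -/
def Achievable (W : DMC X Y) (o : X) (δ ε : ℝ) (n m : ℕ) : Prop :=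
  1 ≤ m ∧ ∃ μ ∈ stdSimplex ℝ (Code X Y n m),
    relEntropy (codeOutput W μ) (blockLaw W (fun _ : Fin n => o)) ≤ ((δ : ℝ) : EReal) ∧
    errorProb W μ ≤ ε

/-- `K_n(δ, ε)`: the largest possible value of `log |M|` (in nats). -/
def maxLogMessages (W : DMC X Y) (o : X) (δ ε : ℝ) (n : ℕ) : EReal :=
  ⨆ (m : ℕ) (_ : Achievable W o δ ε n m), ((Real.log m : ℝ) : EReal)

/-- `liminf_{n → ∞} K_n(δ, ε) / √(n δ)`. -/
def scaling (W : DMC X Y) (o : X) (δ ε : ℝ) : EReal :=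
  liminf (fun n : ℕ => maxLogMessages W o δ ε n / ((Real.sqrt (n * δ) : ℝ) : EReal)) atTop

/-- `L`: the limit of `scaling W o δ ε` as `ε ↓ 0`. -/
def L (W : DMC X Y) (o : X) (δ : ℝ) : EReal :=
  limUnder (𝓝[>] (0 : ℝ)) (scaling W o δ)

theorem scaling_mono (W : DMC X Y) (o : X) (δ : ℝ) : Monotone (scaling W o δ) := by
  intro ε ε' h
  refine liminf_le_liminf (Eventually.of_forall fun n => ?_)
  refine EReal.div_le_div_right_of_nonneg (by exact_mod_cast Real.sqrt_nonneg _) ?_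
  refine iSup_mono fun m => iSup_mono' fun hm => ⟨?_, le_rfl⟩
  obtain ⟨h1, μ, hμ, h2, h3⟩ := hm
  exact ⟨h1, μ, hμ, h2, h3.trans h⟩

/-- The limit that defines `L` exists. -/
theorem tendsto_scaling (W : DMC X Y) (o : X) (δ : ℝ) :
    Tendsto (scaling W o δ) (𝓝[>] (0 : ℝ)) (𝓝 (L W o δ)) :=
  tendsto_nhds_limUnder ⟨_, (scaling_mono W o δ).tendsto_nhdsGT 0⟩

end

end LPD

/-! View (code, message) as the input of a channel whose output is the received block. Fano bounds
`(1 - ε) log m` by its mutual information plus `log 2`, and the golden formula relative to the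
product of `Q*` writes that information as the average divergence of the block laws minus the
divergence of the mixed output.

Full support of an optimal input forces `D(W_x ‖ Q*) = C` for every `x` (`klSum_law_eq_mutualInfo`),
so the first term is `n C` for every code. Put `u = log (Q₀ / Q*)`, whose mean under `Q₀` is also
`C`. Rebasing the second term to `Q₀` and dropping a nonnegative divergence leaves only the amount
by which the mean of `∑ u(Y_i)` falls below `n C`. By Donsker–Varadhan (`mul_mean_drop_le`),
closeness `δ` to the product of `Q₀` limits this drop to `δ / t + n t v / 2` plus lower-order terms,
with `v` the variance of `u`. Optimizing `t`, of order `√(δ / n)`, gives `√(2 v n δ)`. -/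

namespace LPD

open Finset

/-- `∑ a, P a * log (P a / Q a)`, the value of the relative entropy when it is finite. -/
noncomputable def klSum {A : Type*} [Fintype A] (P Q : A → ℝ) : ℝ :=
  ∑ a, P a * Real.log (P a / Q a)

/-! ### Relative entropy on finite sets. -/

section Divergence

variable {A : Type*} [Fintype A]

/-- The Donsker–Varadhan inequality on a finite set. -/
theorem sum_mul_le_klSum_add_log {P R : A → ℝ} (hP : P ∈ stdSimplex ℝ A) (hR : ∀ a, 0 ≤ R a)
    (hac : ∀ a, R a = 0 → P a = 0) (h : A → ℝ) :
    ∑ a, P a * h a ≤ klSum P R + Real.log (∑ a, R a * Real.exp (h a)) := by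
  obtain ⟨hP0, hP1⟩ := hP
  set Z := ∑ a, R a * Real.exp (h a) with hZ
  have hZpos : 0 < Z := by
    obtain ⟨a, -, ha⟩ : ∃ a ∈ univ, 0 < P a := by
      apply exists_lt_of_sum_lt
      simp [hP1]
    have hRa : 0 < R a := (hR a).lt_of_ne fun e => ha.ne' (hac a e.symm)
    exact sum_pos' (fun b _ => mul_nonneg (hR b) (Real.exp_pos _).le)
      ⟨a, mem_univ a, mul_pos hRa (Real.exp_pos _)⟩
  -- This is `log z ≤ z - 1` at `z = R a * exp (h a) / (Z * P a)`, weighted by `P a`; the right side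
  -- sums to zero.
  have key : ∀ a, P a * h a - P a * Real.log (P a / R a) - P a * Real.log Z ≤
      R a * Real.exp (h a) / Z - P a := by
    intro a
    rcases (hP0 a).eq_or_lt with e | ha
    · rw [← e]
      simpa using div_nonneg (mul_nonneg (hR a) (Real.exp_pos _).le) hZpos.le
    · have hRa : 0 < R a := (hR a).lt_of_ne fun e => ha.ne' (hac a e.symm)
      have hpos : 0 < R a * Real.exp (h a) / (Z * P a) := by positivity
      have h1 := Real.log_le_sub_one_of_pos hpos
      rw [Real.log_div (by positivity) (by positivity),
        Real.log_mul hRa.ne' (Real.exp_pos _).ne', Real.log_mul hZpos.ne' ha.ne',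
        Real.log_exp] at h1
      rw [Real.log_div ha.ne' hRa.ne']
      have h2 := mul_le_mul_of_nonneg_left h1 ha.le
      have h3 : P a * (R a * Real.exp (h a) / (Z * P a) - 1) =
          R a * Real.exp (h a) / Z - P a := by
        field_simp
      linarith
  have hs := sum_le_sum fun a (_ : a ∈ univ) => key a
  simp only [sum_sub_distrib, ← sum_mul, ← sum_div, hP1] at hs
  rw [← hZ, div_self hZpos.ne'] at hs
  unfold klSum
  linarith

/-- Nonnegativity of the relative entropy. -/
theorem klSum_nonneg {P R : A → ℝ} (hP : P ∈ stdSimplex ℝ A) (hR : R ∈ stdSimplex ℝ A)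
    (hac : ∀ a, R a = 0 → P a = 0) : 0 ≤ klSum P R := by
  simpa [hR.2] using sum_mul_le_klSum_add_log hP hR.1 hac fun _ => 0

/-- The relative entropy is at most the `χ²`-divergence. -/
theorem klSum_le_sum_sq_div {P R : A → ℝ} (hP : P ∈ stdSimplex ℝ A) (hR : R ∈ stdSimplex ℝ A)
    (hpos : ∀ a, 0 < R a) : klSum P R ≤ ∑ a, (P a - R a) ^ 2 / R a := by
  have key : ∀ a, P a * Real.log (P a / R a) ≤ (P a - R a) ^ 2 / R a + (P a - R a) := by
    intro a
    have hRa := hpos a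
    rcases (hP.1 a).eq_or_lt with e | ha
    · rw [← e]
      apply le_of_eq
      field_simp
      ring
    · have h2 := mul_le_mul_of_nonneg_left
        (Real.log_le_sub_one_of_pos (div_pos ha hRa)) ha.le
      refine h2.trans (le_of_eq ?_)
      field_simp
      ring
  refine (sum_le_sum fun a _ => key a).trans (le_of_eq ?_)
  rw [sum_add_distrib, sum_sub_distrib, hP.2, hR.2]
  ring

/-- The relative entropy of a distribution to a strictly positive one vanishes only if the two
distributions agree. -/
theorem eq_of_klSum_nonpos {P R : A → ℝ} (hP : P ∈ stdSimplex ℝ A) (hR : R ∈ stdSimplex ℝ A)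
    (hpos : ∀ a, 0 < R a) (h : klSum P R ≤ 0) : P = R := by
  -- Subtracting `P a - R a`, which sums to zero, makes every summand nonnegative.
  have key : ∀ a, 0 ≤ P a * Real.log (P a / R a) - (P a - R a) ∧
      (P a * Real.log (P a / R a) - (P a - R a) = 0 → P a = R a) := by
    intro a
    have hRa := hpos a
    rcases (hP.1 a).eq_or_lt with e | ha
    · rw [← e]
      constructor
      · simpa using hRa.le
      · intro h0
        simp at h0
        linarith
    · have e1 : Real.log (P a / R a) = -Real.log (R a / P a) := by
        rw [← Real.log_inv, inv_div]
      have e2 : P a * (R a / P a - 1) = R a - P a := by field_simp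
      constructor
      · have h2 := mul_le_mul_of_nonneg_left
          (Real.log_le_sub_one_of_pos (div_pos hRa ha)) ha.le
        rw [e1]
        linarith
      · intro h0
        by_contra hne
        have h2 := mul_lt_mul_of_pos_left (Real.log_lt_sub_one_of_pos (div_pos hRa ha)
          (by rw [Ne, div_eq_one_iff_eq ha.ne']; exact fun e => hne e.symm)) ha
        rw [e1] at h0
        linarith
  have hsum : ∑ a, (P a * Real.log (P a / R a) - (P a - R a)) = 0 := by
    apply le_antisymm
    · rw [sum_sub_distrib, sum_sub_distrib, hP.2, hR.2]
      unfold klSum at h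
      linarith
    · exact sum_nonneg fun a _ => (key a).1
  rw [sum_eq_zero_iff_of_nonneg fun a _ => (key a).1] at hsum
  exact funext fun a => (key a).2 (hsum a (mem_univ a))

/-- Changing the reference measure of a relative entropy. -/
theorem klSum_eq_klSum_add {P Q R : A → ℝ} (hQ : ∀ a, 0 < Q a) (hR : ∀ a, 0 < R a) :
    klSum P R = klSum P Q + ∑ a, P a * Real.log (Q a / R a) := by
  unfold klSum
  rw [← sum_add_distrib]
  refine sum_congr rfl fun a _ => ?_
  by_cases h : P a = 0
  · simp [h]
  · rw [Real.log_div h (hR a).ne', Real.log_div h (hQ a).ne',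
      Real.log_div (hQ a).ne' (hR a).ne']
    ring

end Divergence

/-! ### Optimality conditions for capacity, and Fano's inequality. -/

section MutualInformation

variable {X Y : Type*} [Fintype X] [Fintype Y]

theorem output_mem_stdSimplex (W : DMC X Y) {P : X → ℝ} (hP : P ∈ stdSimplex ℝ X) :
    output W P ∈ stdSimplex ℝ Y := by
  refine ⟨fun y => sum_nonneg fun x _ => mul_nonneg (hP.1 x) ((W.law_mem x).1 y), ?_⟩
  unfold output
  rw [sum_comm]
  simp_rw [← mul_sum, (W.law_mem _).2, mul_one]
  exact hP.2

theorem mul_law_eq_zero_of_output_eq_zero (W : DMC X Y) {P : X → ℝ} (hP : ∀ x, 0 ≤ P x) {y : Y}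
    (h : output W P y = 0) (x : X) : P x * W.law x y = 0 :=
  (sum_eq_zero_iff_of_nonneg fun x _ => mul_nonneg (hP x) ((W.law_mem x).1 y)).1 h x (mem_univ x)

/-- The "golden formula" for the mutual information. -/
theorem mutualInfo_eq_sub (W : DMC X Y) {P : X → ℝ} (hP : ∀ x, 0 ≤ P x) {Q : Y → ℝ}
    (hQ : ∀ y, 0 < Q y) :
    mutualInfo W P = ∑ x, P x * klSum (W.law x) Q - klSum (output W P) Q := by
  have key : ∀ x y, P x * W.law x y * Real.log (W.law x y / output W P y) =
      P x * (W.law x y * Real.log (W.law x y / Q y)) -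
        P x * W.law x y * Real.log (output W P y / Q y) := by
    intro x y
    by_cases h : P x * W.law x y = 0
    · rw [← mul_assoc, h]
      ring
    · have ho : output W P y ≠ 0 := fun e => h (mul_law_eq_zero_of_output_eq_zero W hP e x)
      have hw : W.law x y ≠ 0 := right_ne_zero_of_mul h
      rw [Real.log_div hw ho, Real.log_div hw (hQ y).ne', Real.log_div ho (hQ y).ne']
      ring
  unfold mutualInfo klSum
  simp_rw [key, sum_sub_distrib, mul_sum]
  congr 1
  rw [sum_comm]
  simp_rw [← sum_mul]
  rfl

theorem output_pos (W : DMC X Y) {P : X → ℝ} (hP : ∀ x, 0 < P x) {o : X}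
    (ho : ∀ y, 0 < W.law o y) (y : Y) : 0 < output W P y :=
  sum_pos' (fun x _ => mul_nonneg (hP x).le ((W.law_mem x).1 y))
    ⟨o, mem_univ o, mul_pos (hP o) (ho y)⟩

/-- The relative entropy of any output law to a positive capacity-achieving output law is at most
the capacity. -/
theorem klSum_law_le_mutualInfo (W : DMC X Y) {P : X → ℝ} (hP : IsCapacityAchieving W P)
    (hpos : ∀ y, 0 < output W P y) (a : X) :
    klSum (W.law a) (output W P) ≤ mutualInfo W P := by
  classical
  obtain ⟨hPs, hmax⟩ := hP
  set Q := output W P with hQ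
  set K := ∑ y, (W.law a y - Q y) ^ 2 / Q y
  have hI : mutualInfo W P = ∑ x, P x * klSum (W.law x) Q := by
    rw [mutualInfo_eq_sub W hPs.1 hpos, ← hQ]
    have : klSum Q Q = 0 := by simp [klSum, div_self (hpos _).ne']
    rw [this, sub_zero]
  -- Move `P` towards the point mass at `a`. The average divergence changes linearly in `t`, while
  -- the output divergence subtracted by the golden formula is at most `t ^ 2 * K`, by the `χ²`
  -- bound.
  have key : ∀ t : ℝ, 0 < t → t ≤ 1 →
      klSum (W.law a) Q ≤ mutualInfo W P + t * K := by
    intro t ht ht1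
    set Pt : X → ℝ := (1 - t) • P + t • Pi.single a 1 with hPt
    have hPts : Pt ∈ stdSimplex ℝ X :=
      convex_stdSimplex ℝ X hPs (single_mem_stdSimplex ℝ a) (by linarith) ht.le (by ring)
    have hval : ∀ F : X → ℝ, ∑ x, Pt x * F x = (1 - t) * ∑ x, P x * F x + t * F a := by
      intro F
      simp [hPt, add_mul, sum_add_distrib, mul_sum, mul_assoc, Pi.single_apply]
    have hout : ∀ y, output W Pt y - Q y = t * (W.law a y - Q y) := by
      intro y
      have := hval fun x => W.law x y
      have e : Q y = ∑ x, P x * W.law x y := rfl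
      unfold output
      rw [this, ← e]
      ring
    have h1 := hmax hPts
    have h2 := klSum_le_sum_sq_div (output_mem_stdSimplex W hPts)
      (output_mem_stdSimplex W hPs) hpos
    have h3 : ∑ y, (output W Pt y - output W P y) ^ 2 / output W P y = t ^ 2 * K := by
      rw [mul_sum]
      refine sum_congr rfl fun y _ => ?_
      rw [← hQ, hout]
      ring
    have h4 : mutualInfo W Pt ≤ mutualInfo W P := h1
    rw [mutualInfo_eq_sub W hPts.1 hpos, hval, ← hI] at h4
    rw [h3, ← hQ] at h2
    have h5 : t * klSum (W.law a) Q ≤ t * (mutualInfo W P + t * K) := by nlinarith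
    exact le_of_mul_le_mul_left h5 ht
  have hlim : Tendsto (fun t : ℝ => mutualInfo W P + t * K) (𝓝[>] 0) (𝓝 (mutualInfo W P)) := by
    have : Continuous fun t : ℝ => mutualInfo W P + t * K := by fun_prop
    simpa using (this.tendsto 0).mono_left nhdsWithin_le_nhds
  refine ge_of_tendsto hlim ?_
  filter_upwards [Ioc_mem_nhdsGT (zero_lt_one (α := ℝ))] with t ht
  exact key t ht.1 ht.2

/-- If a capacity-achieving input distribution charges every symbol, all output laws are at the
same relative entropy from its output law. -/
theorem klSum_law_eq_mutualInfo (W : DMC X Y) {P : X → ℝ} (hP : IsCapacityAchieving W P)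
    (hfull : ∀ x, 0 < P x) (hpos : ∀ y, 0 < output W P y) (a : X) :
    klSum (W.law a) (output W P) = mutualInfo W P := by
  have hle := klSum_law_le_mutualInfo W hP hpos
  have hI : mutualInfo W P = ∑ x, P x * klSum (W.law x) (output W P) := by
    rw [mutualInfo_eq_sub W hP.1.1 hpos]
    have : klSum (output W P) (output W P) = 0 := by simp [klSum, div_self (hpos _).ne']
    rw [this, sub_zero]
  -- The gaps are nonnegative with `P`-average zero, so positive weights force each to vanish.
  have hsum : ∑ x, P x * (mutualInfo W P - klSum (W.law x) (output W P)) = 0 := by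
    simp_rw [mul_sub, sum_sub_distrib, ← sum_mul, hP.1.2, ← hI]
    ring
  rw [sum_eq_zero_iff_of_nonneg fun x _ => mul_nonneg (hfull x).le (sub_nonneg.2 (hle x))] at hsum
  have := (mul_eq_zero.1 (hsum a (mem_univ a))).resolve_left (hfull a).ne'
  linarith

/-- The capacity-achieving output distribution is unique. -/
theorem eq_output_of_isCapacityAchievingOutput (W : DMC X Y) {P : X → ℝ}
    (hP : IsCapacityAchieving W P) (hpos : ∀ y, 0 < output W P y) {Q : Y → ℝ}
    (hQ : IsCapacityAchievingOutput W Q) : Q = output W P := by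
  obtain ⟨P', hP', rfl⟩ := hQ
  apply eq_of_klSum_nonpos (output_mem_stdSimplex W hP'.1) (output_mem_stdSimplex W hP.1) hpos
  have h1 : mutualInfo W P ≤ mutualInfo W P' := hP'.2 hP.1
  rw [mutualInfo_eq_sub W hP'.1.1 hpos] at h1
  have h2 : ∑ x, P' x * klSum (W.law x) (output W P) ≤ ∑ x, P' x * mutualInfo W P :=
    sum_le_sum fun x _ =>
      mul_le_mul_of_nonneg_left (klSum_law_le_mutualInfo W hP hpos x) (hP'.1.1 x)
  rw [← sum_mul, hP'.1.2, one_mul] at h2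
  linarith

/-- Fano's inequality for a decoder `g` that observes the side information `c` and the channel
output and guesses the uniform message `k`. -/
theorem sum_correct_mul_log_le_mutualInfo {C Z : Type*} [Fintype C] [Fintype Z] {m : ℕ}
    (hm : 1 ≤ m) (V : DMC (C × Fin m) Z) {μ : C → ℝ} (hμ : μ ∈ stdSimplex ℝ C)
    (g : C → Z → Fin m) :
    (∑ c, ∑ k, ∑ z with g c z = k, μ c / m * V.law (c, k) z) * Real.log m ≤
      mutualInfo V (fun b => μ b.1 / m) + Real.log 2 := by
  have hm0 : (0 : ℝ) < m := by exact_mod_cast hm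
  set w : C × Fin m → ℝ := fun b => μ b.1 / m with hw
  have hws : w ∈ stdSimplex ℝ (C × Fin m) := by
    refine ⟨fun b => div_nonneg (hμ.1 _) hm0.le, ?_⟩
    rw [Fintype.sum_prod_type]
    simp only [hw, sum_const, card_univ, Fintype.card_fin, nsmul_eq_mul]
    rw [← hμ.2]
    refine sum_congr rfl fun c _ => ?_
    field_simp
  have ho := output_mem_stdSimplex V hws
  -- Donsker–Varadhan for the joint law against the product of its marginals. Under `R` the message
  -- is uniform and independent of the guess, so rewarding a correct guess by `log m` has
  -- exponential moment at most `1 + m * (1 / m) = 2`.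
  set P : (C × Fin m) × Z → ℝ := fun q => w q.1 * V.law q.1 q.2 with hPdef
  set R : (C × Fin m) × Z → ℝ := fun q => w q.1 * output V w q.2 with hRdef
  set h : (C × Fin m) × Z → ℝ := fun q => if g q.1.1 q.2 = q.1.2 then Real.log m else 0 with hh
  have hP : P ∈ stdSimplex ℝ ((C × Fin m) × Z) := by
    refine ⟨fun q => mul_nonneg (hws.1 _) ((V.law_mem _).1 _), ?_⟩
    rw [Fintype.sum_prod_type]
    simp only [hPdef, ← mul_sum, (V.law_mem _).2, mul_one]
    exact hws.2
  have hdv := sum_mul_le_klSum_add_log (R := R) hP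
    (fun q => mul_nonneg (hws.1 _) (ho.1 _)) (fun q hq => by
      rcases mul_eq_zero.1 hq with h0 | h0
      · simp only [hPdef, h0, zero_mul]
      · exact mul_law_eq_zero_of_output_eq_zero V hws.1 h0 q.1) h
  have hkl : klSum P R = mutualInfo V w := by
    unfold klSum mutualInfo
    rw [Fintype.sum_prod_type]
    refine sum_congr rfl fun b _ => sum_congr rfl fun z _ => ?_
    by_cases h0 : w b = 0
    · simp [hPdef, h0]
    · simp only [hPdef, hRdef]
      rw [mul_div_mul_left _ _ h0]
  have hexp : ∑ q, R q * Real.exp (h q) ≤ 2 := by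
    have e1 : ∀ q, R q * Real.exp (h q) ≤
        R q + (if g q.1.1 q.2 = q.1.2 then μ q.1.1 * output V w q.2 else 0) := by
      intro q
      by_cases hq : g q.1.1 q.2 = q.1.2
      · simp only [hh, hq, if_true, Real.exp_log hm0]
        have : R q * m = μ q.1.1 * output V w q.2 := by
          simp only [hRdef, hw]
          field_simp
        have h0 : 0 ≤ R q := mul_nonneg (hws.1 _) (ho.1 _)
        linarith
      · simp [hh, hq]
    refine (sum_le_sum fun q _ => e1 q).trans (le_of_eq ?_)
    rw [sum_add_distrib]
    have s1 : ∑ q, R q = 1 := by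
      rw [Fintype.sum_prod_type]
      simp only [hRdef, ← mul_sum, ho.2, mul_one]
      exact hws.2
    have s2 : ∑ q : (C × Fin m) × Z,
        (if g q.1.1 q.2 = q.1.2 then μ q.1.1 * output V w q.2 else 0) = 1 := by
      rw [Fintype.sum_prod_type, Fintype.sum_prod_type]
      calc _ = ∑ c, ∑ z, μ c * output V w z := by
            refine sum_congr rfl fun c _ => ?_
            rw [sum_comm]
            refine sum_congr rfl fun z _ => ?_
            simp
        _ = 1 := by simp only [← mul_sum, ho.2, mul_one, hμ.2]
    rw [s1, s2]
    norm_num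
  have hexp0 : 0 < ∑ q, R q * Real.exp (h q) := by
    have hR1 : ∑ q, R q = 1 := by
      rw [Fintype.sum_prod_type]
      simp only [hRdef, ← mul_sum, ho.2, mul_one]
      exact hws.2
    refine lt_of_lt_of_le zero_lt_one (hR1 ▸ sum_le_sum fun q _ => ?_)
    refine le_mul_of_one_le_right (mul_nonneg (hws.1 _) (ho.1 _)) (Real.one_le_exp ?_)
    simp only [hh]
    split_ifs
    · exact Real.log_nonneg (by exact_mod_cast hm)
    · exact le_rfl
  have hlhs : ∑ q, P q * h q =
      (∑ c, ∑ k, ∑ z with g c z = k, μ c / m * V.law (c, k) z) * Real.log m := by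
    rw [Fintype.sum_prod_type, Fintype.sum_prod_type]
    simp only [sum_mul, sum_filter, hPdef, hh, hw, ite_mul, zero_mul, mul_ite, mul_zero]
  rw [hlhs, hkl] at hdv
  have := Real.log_le_log hexp0 hexp
  linarith

end MutualInformation

/-! ### Product laws and exponential moments. -/

section Product

variable {Y : Type*} [Fintype Y]

theorem sum_prod_eq_prod_sum {n : ℕ} (p : Fin n → Y → ℝ) :
    ∑ y : Fin n → Y, ∏ i, p i (y i) = ∏ i, ∑ b, p i b := by
  classical
  rw [prod_univ_sum, Fintype.piFinset_univ]

theorem prod_mem_stdSimplex {n : ℕ} {p : Fin n → Y → ℝ} (hp : ∀ i, p i ∈ stdSimplex ℝ Y) :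
    (fun y : Fin n → Y => ∏ i, p i (y i)) ∈ stdSimplex ℝ (Fin n → Y) := by
  refine ⟨fun y => prod_nonneg fun i _ => (hp i).1 _, ?_⟩
  rw [sum_prod_eq_prod_sum]
  exact prod_eq_one fun i _ => (hp i).2

/-- The mean of a sum of functions of the coordinates under a product distribution. -/
theorem sum_prod_mul_sum {n : ℕ} {p : Fin n → Y → ℝ} (hp : ∀ i, ∑ b, p i b = 1)
    (f : Fin n → Y → ℝ) :
    ∑ y : Fin n → Y, (∏ i, p i (y i)) * ∑ i, f i (y i) = ∑ i, ∑ b, p i b * f i b := by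
  classical
  simp_rw [mul_sum]
  rw [sum_comm]
  refine sum_congr rfl fun i _ => ?_
  -- Absorbing `f i` into the `i`-th factor keeps the integrand a product.
  have h1 : ∀ y : Fin n → Y, (∏ j, p j (y j)) * f i (y i) =
      ∏ j, Function.update p i (fun b => p i b * f i b) j (y j) := by
    intro y
    rw [← mul_prod_erase univ _ (mem_univ i), ← mul_prod_erase univ
      (fun j => Function.update p i (fun b => p i b * f i b) j (y j)) (mem_univ i)]
    have : ∏ j ∈ univ.erase i, Function.update p i (fun b => p i b * f i b) j (y j) =
        ∏ j ∈ univ.erase i, p j (y j) :=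
      prod_congr rfl fun j hj => by rw [Function.update_of_ne (ne_of_mem_erase hj)]
    rw [this, Function.update_self]
    ring
  simp_rw [h1]
  rw [sum_prod_eq_prod_sum, ← mul_prod_erase univ _ (mem_univ i), Function.update_self]
  rw [prod_eq_one, mul_one]
  intro j hj
  rw [Function.update_of_ne (ne_of_mem_erase hj), hp j]

theorem log_prod_div_prod {n : ℕ} {a b : Fin n → ℝ} (ha : ∀ i, a i ≠ 0) (hb : ∀ i, b i ≠ 0) :
    Real.log ((∏ i, a i) / ∏ i, b i) = ∑ i, Real.log (a i / b i) := by
  rw [← prod_div_distrib, Real.log_prod fun i _ => div_ne_zero (ha i) (hb i)]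

/-- The relative entropy of product distributions is additive. -/
theorem klSum_prod {n : ℕ} {p : Fin n → Y → ℝ} (hp : ∀ i, p i ∈ stdSimplex ℝ Y) {Q : Y → ℝ}
    (hQ : ∀ b, 0 < Q b) :
    klSum (fun y : Fin n → Y => ∏ i, p i (y i)) (fun y => ∏ i, Q (y i)) =
      ∑ i, klSum (p i) Q := by
  unfold klSum
  rw [← sum_prod_mul_sum (fun i => (hp i).2) fun i b => Real.log (p i b / Q b)]
  refine sum_congr rfl fun y _ => ?_
  by_cases h : ∏ i, p i (y i) = 0
  · simp [h]
  · replace h := prod_ne_zero_iff.1 h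
    rw [log_prod_div_prod (fun i => h i (mem_univ i)) fun i => (hQ _).ne']

/-- A second-order bound on the exponential moment of a centred bounded function. -/
theorem sum_mul_exp_le {Q : Y → ℝ} (hQ : Q ∈ stdSimplex ℝ Y) (u : Y → ℝ) {B : ℝ}
    (hB : ∀ b, |u b - mean Q u| ≤ B) {t : ℝ} (ht : 0 ≤ t) (htB : t * B ≤ 1) :
    ∑ b, Q b * Real.exp (t * (mean Q u - u b)) ≤
      Real.exp (t ^ 2 * variance Q u / 2 + t ^ 3 * B ^ 3) := by
  have key : ∀ b, Real.exp (t * (mean Q u - u b)) ≤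
      1 + t * (mean Q u - u b) + t ^ 2 * (u b - mean Q u) ^ 2 / 2 + t ^ 3 * B ^ 3 := by
    intro b
    have hle : |t * (mean Q u - u b)| ≤ t * B := by
      rw [abs_mul, abs_of_nonneg ht, abs_sub_comm]
      exact mul_le_mul_of_nonneg_left (hB b) ht
    -- The cubic remainder has constant `2 / 9`, rounded up to `1` below.
    have h1 := Real.exp_bound (hle.trans htB) (n := 3) (by norm_num)
    simp only [sum_range_succ, range_zero, sum_empty] at h1
    norm_num [Nat.factorial] at h1
    have h2 := le_of_abs_le h1
    have h3 : |t * (mean Q u - u b)| ^ 3 ≤ (t * B) ^ 3 :=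
      pow_le_pow_left₀ (abs_nonneg _) hle 3
    rw [abs_mul] at h3
    have h4 : 0 ≤ (t * B) ^ 3 := (by positivity : 0 ≤ (|t| * |mean Q u - u b|) ^ 3).trans h3
    nlinarith
  have hmean : ∑ b, Q b * (mean Q u - u b) = 0 := by
    simp_rw [mul_sub, sum_sub_distrib, ← sum_mul, hQ.2]
    simp [mean]
  calc ∑ b, Q b * Real.exp (t * (mean Q u - u b))
      ≤ ∑ b, Q b * (1 + t * (mean Q u - u b) + t ^ 2 * (u b - mean Q u) ^ 2 / 2 +
          t ^ 3 * B ^ 3) :=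
        sum_le_sum fun b _ => mul_le_mul_of_nonneg_left (key b) (hQ.1 b)
    _ = ∑ b, (Q b + t * (Q b * (mean Q u - u b)) +
          t ^ 2 / 2 * (Q b * (u b - mean Q u) ^ 2) + t ^ 3 * B ^ 3 * Q b) :=
        sum_congr rfl fun b _ => by ring
    _ = t ^ 2 * variance Q u / 2 + t ^ 3 * B ^ 3 + 1 := by
        simp_rw [sum_add_distrib, ← mul_sum, hmean, hQ.2, variance]
        ring
    _ ≤ _ := Real.add_one_le_exp _

/-- If `R` is within relative entropy `δ` of a product distribution, the mean of a sum
of a function of the coordinates cannot drop by much under `R`. -/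
theorem mul_mean_drop_le {n : ℕ} {Q : Y → ℝ} (hQ : Q ∈ stdSimplex ℝ Y) (hpos : ∀ b, 0 < Q b)
    (u : Y → ℝ) {B : ℝ} (hB : ∀ b, |u b - mean Q u| ≤ B) {t : ℝ} (ht : 0 ≤ t) (htB : t * B ≤ 1)
    {R : (Fin n → Y) → ℝ} (hR : R ∈ stdSimplex ℝ (Fin n → Y)) {δ : ℝ}
    (hδ : klSum R (fun y => ∏ i, Q (y i)) ≤ δ) :
    t * (n * mean Q u - ∑ y, R y * ∑ i, u (y i)) ≤
      δ + n * (t ^ 2 * variance Q u / 2 + t ^ 3 * B ^ 3) := by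
  have hprod : ∀ y : Fin n → Y, 0 < ∏ i, Q (y i) := fun y => prod_pos fun i _ => hpos _
  have hdv := sum_mul_le_klSum_add_log hR (fun y => (hprod y).le)
    (fun y h => absurd h (hprod y).ne') fun y => ∑ i, t * (mean Q u - u (y i))
  have hl : ∑ y, R y * ∑ i, t * (mean Q u - u (y i)) =
      t * (n * mean Q u - ∑ y, R y * ∑ i, u (y i)) := by
    have : ∀ y : Fin n → Y, R y * ∑ i, t * (mean Q u - u (y i)) =
        t * (n * mean Q u) * R y - t * (R y * ∑ i, u (y i)) := by
      intro y
      rw [← mul_sum, sum_sub_distrib]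
      simp
      ring
    simp_rw [this, sum_sub_distrib, ← mul_sum, hR.2]
    ring
  have hm : ∑ y : Fin n → Y, (∏ i, Q (y i)) * Real.exp (∑ i, t * (mean Q u - u (y i))) =
      (∑ b, Q b * Real.exp (t * (mean Q u - u b))) ^ n := by
    simp_rw [Real.exp_sum, ← prod_mul_distrib]
    rw [sum_prod_eq_prod_sum fun _ b => Q b * Real.exp (t * (mean Q u - u b))]
    simp
  have hs := sum_mul_exp_le hQ u hB ht htB
  have hne : (univ : Finset Y).Nonempty := by
    by_contra h
    have := hQ.2
    rw [not_nonempty_iff_eq_empty.1 h] at this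
    simp at this
  have hs0 : 0 < ∑ b, Q b * Real.exp (t * (mean Q u - u b)) :=
    sum_pos (fun b _ => mul_pos (hpos b) (Real.exp_pos _)) hne
  have hlog := Real.log_le_log hs0 hs
  rw [Real.log_exp] at hlog
  rw [hl, hm, Real.log_pow] at hdv
  have := mul_le_mul_of_nonneg_left hlog (Nat.cast_nonneg (α := ℝ) n)
  linarith

theorem blockLaw_mem_stdSimplex {X : Type*} (W : DMC X Y) {n : ℕ} (x : Fin n → X) :
    blockLaw W x ∈ stdSimplex ℝ (Fin n → Y) :=
  prod_mem_stdSimplex fun i => W.law_mem (x i)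

end Product

/-! ### The converse at finite blocklength and in the limit. -/

section Converse

variable {X Y : Type*} [Fintype X] [Fintype Y]

variable [DecidableEq Y]

/-- The channel from the pair (code, message) to the block of channel outputs. -/
def codeChannel (W : DMC X Y) (n m : ℕ) : DMC (Code X Y n m × Fin m) (Fin n → Y) where
  law b := blockLaw W (b.1.1 b.2)
  law_mem _ := blockLaw_mem_stdSimplex W _

theorem output_codeChannel (W : DMC X Y) {n m : ℕ} (μ : Code X Y n m → ℝ) :
    output (codeChannel W n m) (fun b => μ b.1 / m) = codeOutput W μ := by
  funext y
  unfold output codeOutput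
  rw [Fintype.sum_prod_type]
  refine sum_congr rfl fun c _ => ?_
  rw [sum_div, mul_sum]
  refine sum_congr rfl fun k _ => ?_
  simp only [codeChannel]
  ring

theorem weight_mem_stdSimplex {n m : ℕ} (hm : 1 ≤ m) {μ : Code X Y n m → ℝ}
    (hμ : μ ∈ stdSimplex ℝ (Code X Y n m)) :
    (fun b : Code X Y n m × Fin m => μ b.1 / m) ∈ stdSimplex ℝ (Code X Y n m × Fin m) := by
  have hm0 : (0 : ℝ) < m := by exact_mod_cast hm
  refine ⟨fun b => div_nonneg (hμ.1 _) hm0.le, ?_⟩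
  rw [Fintype.sum_prod_type]
  simp only [sum_const, card_univ, Fintype.card_fin, nsmul_eq_mul]
  rw [← hμ.2]
  refine sum_congr rfl fun c _ => ?_
  field_simp

theorem sum_correct_eq (W : DMC X Y) {n m : ℕ} (hm : 1 ≤ m) {μ : Code X Y n m → ℝ}
    (hμ : μ ∈ stdSimplex ℝ (Code X Y n m)) :
    ∑ c, ∑ k, ∑ y with c.2 y = k, μ c / m * (codeChannel W n m).law (c, k) y =
      1 - errorProb W μ := by
  have hm0 : (0 : ℝ) < m := by exact_mod_cast hm
  have h : ∀ c : Code X Y n m,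
      ∑ k, ∑ y with c.2 y = k, μ c / m * (codeChannel W n m).law (c, k) y =
        μ c - μ c * ((∑ k, ∑ y with c.2 y ≠ k, blockLaw W (c.1 k) y) / m) := by
    intro c
    have h1 : ∀ k, ∑ y with c.2 y = k, blockLaw W (c.1 k) y =
        1 - ∑ y with c.2 y ≠ k, blockLaw W (c.1 k) y := by
      intro k
      rw [← (blockLaw_mem_stdSimplex W (c.1 k)).2,
        ← sum_filter_add_sum_filter_not univ (fun y => c.2 y = k)]
      ring
    simp_rw [← mul_sum]
    simp only [codeChannel]
    simp_rw [h1, sum_sub_distrib]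
    simp only [sum_const, card_univ, Fintype.card_fin, nsmul_eq_mul]
    field_simp
  simp_rw [h, sum_sub_distrib, hμ.2]
  rfl

/-- The finite-blocklength converse. -/
theorem one_sub_mul_log_le (W : DMC X Y) {o : X} (hsupp : ∀ y, 0 < W.law o y) {Q : Y → ℝ}
    (hQpos : ∀ y, 0 < Q y) {C : ℝ} (hC : ∀ x, klSum (W.law x) Q = C) {B : ℝ}
    (hB : ∀ b, |Real.log (W.law o b / Q b) -
      mean (W.law o) (fun y => Real.log (W.law o y / Q y))| ≤ B)
    {δ ε : ℝ} {n m : ℕ} (h : Achievable W o δ ε n m) {t : ℝ} (ht : 0 < t) (htB : t * B ≤ 1) :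
    (1 - ε) * Real.log m ≤ δ / t +
      n * (t * variance (W.law o) (fun y => Real.log (W.law o y / Q y)) / 2 + t ^ 2 * B ^ 3) +
        Real.log 2 := by
  obtain ⟨hm, μ, hμ, hD, hε⟩ := h
  set u : Y → ℝ := fun y => Real.log (W.law o y / Q y) with hu
  have hw := weight_mem_stdSimplex hm hμ
  have hout := output_mem_stdSimplex (codeChannel W n m) hw
  have hlogm : 0 ≤ Real.log m := Real.log_nonneg (by exact_mod_cast hm)
  have hfano := sum_correct_mul_log_le_mutualInfo hm (codeChannel W n m) hμ fun c => c.2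
  rw [sum_correct_eq W hm hμ] at hfano
  have hQn : ∀ y : Fin n → Y, 0 < ∏ i, Q (y i) := fun y => prod_pos fun i _ => hQpos _
  have hOn : ∀ y : Fin n → Y, 0 < blockLaw W (fun _ => o) y :=
    fun y => prod_pos fun i _ => hsupp _
  have hblock : ∀ b, klSum ((codeChannel W n m).law b) (fun y => ∏ i, Q (y i)) = n * C := by
    intro b
    refine (klSum_prod (fun i => W.law_mem (b.1.1 b.2 i)) hQpos).trans ?_
    simp [hC]
  rw [mutualInfo_eq_sub _ hw.1 hQn] at hfano
  simp_rw [hblock] at hfano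
  rw [← sum_mul, hw.2, klSum_eq_klSum_add hOn hQn, output_codeChannel] at hfano
  rw [output_codeChannel] at hout
  have hkl : klSum (codeOutput W μ) (blockLaw W (fun _ : Fin n => o)) ≤ δ := by
    unfold relEntropy at hD
    rw [if_pos fun a ha => absurd ha (hOn a).ne'] at hD
    exact_mod_cast hD
  have hkl0 : 0 ≤ klSum (codeOutput W μ) (blockLaw W (fun _ : Fin n => o)) :=
    klSum_nonneg hout (blockLaw_mem_stdSimplex W _) fun a ha => absurd ha (hOn a).ne'
  -- The off symbol also has divergence `C`, so `n * C` is the baseline from which the drop is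
  -- measured.
  have hCmean : C = mean (W.law o) u := (hC o).symm
  have hlog : ∀ y : Fin n → Y,
      Real.log (blockLaw W (fun _ => o) y / ∏ i, Q (y i)) = ∑ i, u (y i) := fun y =>
    log_prod_div_prod (fun i => (hsupp _).ne') fun i => (hQpos _).ne'
  simp_rw [hlog] at hfano
  have hdrop := mul_mean_drop_le (W.law_mem o) hsupp u hB ht.le htB hout hkl
  rw [← hCmean] at hdrop
  have hdiv : n * C - ∑ y, codeOutput W μ y * ∑ i, u (y i) ≤
      δ / t + n * (t * variance (W.law o) u / 2 + t ^ 2 * B ^ 3) := by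
    refine le_of_mul_le_mul_left (hdrop.trans (le_of_eq ?_)) ht
    field_simp
  have hε' : (1 - ε) * Real.log m ≤ (1 - errorProb W μ) * Real.log m :=
    mul_le_mul_of_nonneg_right (by linarith) hlogm
  linarith

/-- The asymptotic converse at a fixed error probability, before optimizing over `r`. -/
theorem scaling_le (W : DMC X Y) {o : X} (hsupp : ∀ y, 0 < W.law o y) {Q : Y → ℝ}
    (hQpos : ∀ y, 0 < Q y) {C : ℝ} (hC : ∀ x, klSum (W.law x) Q = C)
    {δ ε : ℝ} (hδ : 0 < δ) (hε : ε < 1) {r : ℝ} (hr : 0 < r) :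
    scaling W o δ ε ≤ (((1 / r +
      r * variance (W.law o) (fun y => Real.log (W.law o y / Q y)) / 2) / (1 - ε) : ℝ) :
        EReal) := by
  set u : Y → ℝ := fun y => Real.log (W.law o y / Q y) with hu
  set v := variance (W.law o) u
  set B : ℝ := ∑ b, |u b - mean (W.law o) u|
  have hB : ∀ b, |u b - mean (W.law o) u| ≤ B := fun b =>
    single_le_sum (f := fun b => |u b - mean (W.law o) u|) (fun _ _ => abs_nonneg _) (mem_univ b)
  have hε0 : 0 < 1 - ε := by linarith
  set D : ℝ := r ^ 2 * δ * B ^ 3 + Real.log 2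
  have hsq : Tendsto (fun n : ℕ => Real.sqrt (n * δ)) atTop atTop :=
    Real.tendsto_sqrt_atTop.comp (tendsto_natCast_atTop_atTop.atTop_mul_const hδ)
  have hlim : Tendsto (fun n : ℕ => (1 / r + r * v / 2 + D / Real.sqrt (n * δ)) / (1 - ε)) atTop
      (𝓝 ((1 / r + r * v / 2) / (1 - ε))) := by
    simpa using ((tendsto_const_nhds (x := 1 / r + r * v / 2)).add
      (hsq.const_div_atTop D)).div_const (1 - ε)
  have hlim' := ((continuous_coe_real_ereal.tendsto _).comp hlim).liminf_eq
  rw [← hlim']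
  refine liminf_le_liminf ?_
  filter_upwards [hsq.eventually_ge_atTop (r * δ * B), hsq.eventually_gt_atTop 0] with n hn hn0
  have hsqsq : Real.sqrt (n * δ) ^ 2 = n * δ := Real.sq_sqrt (by positivity)
  set s := Real.sqrt (n * δ)
  have hle : maxLogMessages W o δ ε n ≤
      (((1 / r + r * v / 2 + D / s) / (1 - ε) * s : ℝ) : EReal) := by
    refine iSup₂_le fun m hm => EReal.coe_le_coe_iff.2 ?_
    -- With `t = r * δ / s`, both `δ / t` and `n * t * v / 2` are of order `s`; the cubic remainder
    -- contributes the bounded `r ^ 2 * δ * B ^ 3` in `D`.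
    have ht : 0 < r * δ / s := by positivity
    have h1 := one_sub_mul_log_le W hsupp hQpos hC hB hm ht
      (by rw [div_mul_eq_mul_div, div_le_one hn0]; exact hn)
    rw [← hu] at h1
    have hn' : (n : ℝ) = s ^ 2 / δ := by rw [hsqsq]; field_simp
    have h2 : δ / (r * δ / s) + n * (r * δ / s * v / 2 + (r * δ / s) ^ 2 * B ^ 3) + Real.log 2 =
        (1 / r + r * v / 2 + D / s) * s := by
      rw [hn']
      simp only [D]
      field_simp
      ring
    rw [h2] at h1
    rw [div_mul_eq_mul_div, le_div_iff₀ hε0]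
    linarith
  refine (EReal.div_le_div_right_of_nonneg (by exact_mod_cast hn0.le) hle).trans (le_of_eq ?_)
  rw [← EReal.coe_div, mul_div_cancel_right₀ _ hn0.ne']
  rfl

theorem L_le (W : DMC X Y) {o : X} (hsupp : ∀ y, 0 < W.law o y) {Q : Y → ℝ}
    (hQpos : ∀ y, 0 < Q y) {C : ℝ} (hC : ∀ x, klSum (W.law x) Q = C)
    {δ : ℝ} (hδ : 0 < δ) {r : ℝ} (hr : 0 < r) :
    L W o δ ≤ ((1 / r +
      r * variance (W.law o) (fun y => Real.log (W.law o y / Q y)) / 2 : ℝ) : EReal) := by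
  set v := variance (W.law o) (fun y => Real.log (W.law o y / Q y))
  have hlim : Tendsto (fun ε : ℝ => (((1 / r + r * v / 2) / (1 - ε) : ℝ) : EReal)) (𝓝[>] 0)
      (𝓝 ((1 / r + r * v / 2 : ℝ) : EReal)) := by
    have h1 : Tendsto (fun ε : ℝ => 1 - ε) (𝓝[>] 0) (𝓝 1) := by
      have : Continuous fun ε : ℝ => 1 - ε := by fun_prop
      simpa using (this.tendsto 0).mono_left nhdsWithin_le_nhds
    have h2 := (tendsto_const_nhds (x := 1 / r + r * v / 2)).div h1 one_ne_zero
    rw [div_one] at h2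
    exact (continuous_coe_real_ereal.tendsto _).comp h2
  refine le_of_tendsto_of_tendsto (tendsto_scaling W o δ) hlim ?_
  filter_upwards [Ioo_mem_nhdsGT (zero_lt_one (α := ℝ))] with ε hε
  exact scaling_le W hsupp hQpos hC hδ hε.2 hr

end Converse

theorem variance_nonneg {A : Type*} [Fintype A] {Q : A → ℝ} (hQ : ∀ a, 0 ≤ Q a) (f : A → ℝ) :
    0 ≤ variance Q f :=
  sum_nonneg fun a _ => mul_nonneg (hQ a) (sq_nonneg _)

/-- Optimizing `1 / r + r * v / 2` over `r > 0`. -/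
theorem le_sqrt_of_forall_le {x : EReal} {v : ℝ} (hv : 0 ≤ v)
    (h : ∀ r : ℝ, 0 < r → x ≤ ((1 / r + r * v / 2 : ℝ) : EReal)) :
    x ≤ ((Real.sqrt (2 * v) : ℝ) : EReal) := by
  rcases hv.eq_or_lt with rfl | hv
  -- For `v = 0` the infimum is not attained, so `r` tends to infinity.
  · have hlim : Tendsto (fun r : ℝ => ((1 / r + r * 0 / 2 : ℝ) : EReal)) atTop
        (𝓝 ((Real.sqrt (2 * 0) : ℝ) : EReal)) := by
      refine (continuous_coe_real_ereal.tendsto _).comp ?_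
      simpa using tendsto_inv_atTop_zero (𝕜 := ℝ)
    refine ge_of_tendsto hlim ?_
    filter_upwards [eventually_gt_atTop 0] with r hr using h r hr
  · have hs : 0 < Real.sqrt (2 * v) := Real.sqrt_pos.2 (by linarith)
    have hs2 : Real.sqrt (2 * v) ^ 2 = 2 * v := Real.sq_sqrt (by linarith)
    -- This `r` makes the two terms equal.
    refine (h (2 / Real.sqrt (2 * v)) (by positivity)).trans (le_of_eq ?_)
    congr 1
    field_simp
    linarith

end LPD

theorem theorem3 {X Y : Type*} [Fintype X] [Fintype Y] [DecidableEq Y]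
    (W : LPD.DMC X Y) (o : X)
    (hsupp : ∀ y, 0 < W.law o y)
    (hall : ∃ P : X → ℝ, LPD.IsCapacityAchieving W P ∧ ∀ x, 0 < P x)
    (Qstar : Y → ℝ) (hQ : LPD.IsCapacityAchievingOutput W Qstar)
    (δ : ℝ) (hδ : 0 < δ) :
    LPD.L W o δ ≤
      ((Real.sqrt (2 * LPD.variance (W.law o)
        (fun y => Real.log (W.law o y / Qstar y))) : ℝ) : EReal) := by
  obtain ⟨P, hP, hfull⟩ := hall
  have hpos := LPD.output_pos W hfull hsupp
  obtain rfl := LPD.eq_output_of_isCapacityAchievingOutput W hP hpos hQ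
  exact LPD.le_sqrt_of_forall_le (LPD.variance_nonneg (W.law_mem o).1 _) fun r hr =>
    LPD.L_le W hsupp hpos (LPD.klSum_law_eq_mutualInfo W hP hfull hpos) hδ hr
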